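/- Let $A$ be a finite alphabet with an involution $\theta:A\to A$, possibly with fixed points; write $a^{-1}=\theta(a)$ and $(a_1\cdots a_n)^{-1}=a_n^{-1}\cdots a_1^{-1}$. \textbf{Linear involutions.} Let $I$ be a nonempty bounded open interval, $\hat I=I\times\{0,1\}$, let $\ell+m=k=\mathrm{Card}(A)$, let $\pi:\{1,\dots,k\}\to A$ be a bijection, and let $\lambda_a>0$ $(a\in A)$ be such that $\lambda_a=\lambda_{a^{-1}}$ for all $a\in A$ and $\lambda_{\pi(1)}+\dots+\lambda_{\pi(\ell)}=\lambda_{\pi(\ell+1)}+\dots+\lambda_{\pi(k)}=|I|$. Divide $I\times\{0\}$, from left to right, into consecutive open intervals $I_{\pi(1)},\dots,I_{\pi(\ell)}$ and $I\times\{1\}$ into consecutive open intervals $I_{\pi(\ell+1)},\dots,I_{\pi(k)}$, where $I_a$ has length $\lambda_a$, and let $\Sigma\subset\hat I$ be the set of the $k-2$ division points separating them. Let $\sigma_1$ be an involution of $\hat I\setminus\Sigma$ whose restriction to each $I_a$ is either a translation or a symmetry (reflection) from $I_a$ onto $I_{a^{-1}}$, and let $\sigma_2(x,\delta)=(x,1-\delta)$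 on $\hat I$. The map $T=\sigma_2\circ\sigma_1$, defined on $\hat I\setminus\Sigma$, is called a \emph{linear involution}. A \emph{connection} of $T$ is a triple $(x,y,n)$ with $x\in\sigma_2(\Sigma)$, $y\in\Sigma$, $n\ge 0$ and $T^n x=y$ (in particular $T^n$ is defined at $x$). \textbf{Natural coding.} Let $O=\bigcup_{n\ge0}T^{-n}(\Sigma)$ and $\hat O=O\cup\sigma_2(O)$. The infinite natural coding of $T$ relative to $z\in\hat I\setminus\hat O$ is the infinite word $a_0a_1a_2\cdots$ with $a_n=a$ if $T^n(z)\in I_a$. The \emph{natural coding} $\mathcal L(T)$ of $T$ is the set of all finite factors (including the empty word) of the infinite natural codings of $T$. \textbf{Specular sets.} A set $S$ of words over $A$ is \emph{factorial} if it contains $A$ and all factors of its elements; it is \emph{biextendable} if it is factorial and for every $w\in S$ there are $a,b\in A$ with $awb\in S$. For $w\in S$, the extension graph $\mathcal E(w)$ is the undirected bipartite graph whose vertex set is the disjoint union of $\{a\in A: aw\in S\}$ and $\{b\in A: wb\in S\}$ and whose edges are the pairs $(a,b)$ with $awb\in S$. The set $S$ is \emph{specular} (relative to $\theta$) if it is biextendable,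 all its words are reduced (they have no factor $aa^{-1}$ with $a\in A$), $w^{-1}\in S$ for all $w\in S$, $\mathcal E(w)$ is a tree for every nonempty $w\in S$, and $\mathcal E(\varepsilon)$ is a disjoint union of exactly two trees. \textbf{Theorem.} If $T$ is a linear involution without connections, then $\mathcal L(T)$ is a specular set relative to $\theta$. -/

import Mathlib

/-! ### Sets of words -/

/-- A set of words is factorial if it contains the alphabet and all the factors of its elements. -/
def IsFactorialSet {A : Type*} (S : Set (List A)) : Prop :=
  (∀ a : A, [a] ∈ S) ∧ ∀ w ∈ S, ∀ v : List A, v <:+: w → v ∈ S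

/-- A factorial set is biextendable if every `w ∈ S` satisfies `awb ∈ S` for some letters `a, b`. -/
def IsBiextendableSet {A : Type*} (S : Set (List A)) : Prop :=
  IsFactorialSet S ∧ ∀ w ∈ S, ∃ a b : A, a :: (w ++ [b]) ∈ S

/-- The extension graph of `w` in `S`: its vertices are the disjoint union of
`L(w) = {a | aw ∈ S}` and `R(w) = {b | wb ∈ S}`, and its edges are the pairs
`(a, b) ∈ L(w) × R(w)` with `awb ∈ S`. -/
def extensionGraph {A : Type*} (S : Set (List A)) (w : List A) :
    SimpleGraph ({a : A // a :: w ∈ S} ⊕ {b : A // w ++ [b] ∈ S}) where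
  Adj x y :=
    match x, y with
    | Sum.inl a, Sum.inr b => a.1 :: (w ++ [b.1]) ∈ S
    | Sum.inr b, Sum.inl a => a.1 :: (w ++ [b.1]) ∈ S
    | _, _ => False
  symm := by
    constructor
    rintro (a | b) (a' | b') h <;> exact h
  loopless := by
    constructor
    rintro (a | b) h <;> exact h

/-- A tree set of characteristic `c`: a biextendable set such that the extension graph of every
nonempty word is a tree and the extension graph of the empty word is a union of `c` trees, that is
to say, a forest with exactly `c` connected components. -/
def IsTreeSet {A : Type*} (S : Set (List A)) (c : ℕ) : Prop :=
  IsBiextendableSet S ∧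
  (∀ w ∈ S, w ≠ [] → (extensionGraph S w).IsTree) ∧
  (extensionGraph S []).IsAcyclic ∧
  Nat.card (extensionGraph S []).ConnectedComponent = c

/-- A word is reduced (relative to `θ`, where `θ a` is the inverse of `a`) if it has no factor
`a (θ a)`. -/
def IsReducedWord {A : Type*} (θ : A → A) (w : List A) : Prop :=
  w.IsChain (fun a b => b ≠ θ a)

/-- The inverse `θ(aₙ) ⋯ θ(a₁)` of the word `a₁ ⋯ aₙ`. -/
def inverseWord {A : Type*} (θ : A → A) (w : List A) : List A :=
  (w.map θ).reverse

/-- A laminary set: a biextendable set of reduced words that is closed under taking inverses. -/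
def IsLaminarySet {A : Type*} (θ : A → A) (S : Set (List A)) : Prop :=
  IsBiextendableSet S ∧ (∀ w ∈ S, IsReducedWord θ w) ∧ ∀ w ∈ S, inverseWord θ w ∈ S

/-- A specular set: a laminary set that is a tree set of characteristic `2`. -/
def IsSpecularSet {A : Type*} (θ : A → A) (S : Set (List A)) : Prop :=
  IsLaminarySet θ S ∧ IsTreeSet S 2

/-! ### Linear involutions -/

/-- The data of a linear involution on the open interval `I = (left, right)` relative to the
alphabet `A` with the involution `θ` (which is `a ↦ a⁻¹`): a generalized permutation `perm` of type
`(ℓ, m)`, here indexed from `0`, a length data `len`, and for each letter the information whether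
`σ₁` restricts to a symmetry (`flip a = true`) or to a translation (`flip a = false`)
from `I_a` onto `I_{θ a}`; the compatibility `flip_inv` expresses that `σ₁` is an involution.
In `I × {0, 1}`, component `0` is `false` and component `1` is `true`. -/
structure LinearInvolution (A : Type*) (θ : A → A) where
  left : ℝ
  right : ℝ
  left_lt_right : left < right
  ℓ : ℕ
  m : ℕ
  perm : Fin (ℓ + m) ≃ A
  len : A → ℝ
  len_pos : ∀ a, 0 < len a
  len_inv : ∀ a, len (θ a) = len a
  sum_top : ∑ i : Fin ℓ, len (perm (Fin.castAdd m i)) = right - left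
  sum_bot : ∑ j : Fin m, len (perm (Fin.natAdd ℓ j)) = right - left
  flip : A → Bool
  flip_inv : ∀ a, flip (θ a) = flip a

namespace LinearInvolution

variable {A : Type*} {θ : A → A} (T : LinearInvolution A θ)

/-- `I × {0, 1}`. -/
def space : Set (ℝ × Bool) := Set.Ioo T.left T.right ×ˢ Set.univ

/-- The component of the `i`-th interval: `0` for the first `ℓ` ones, `1` for the `m` others. -/
def row (i : Fin (T.ℓ + T.m)) : Bool := decide (T.ℓ ≤ i.val)

/-- The left endpoint of the `i`-th interval: the intervals of each component are placed
consecutively from the left endpoint of `I`, in the order given by the generalized permutation. -/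
def leftEnd (i : Fin (T.ℓ + T.m)) : ℝ :=
  T.left + ∑ j : Fin (T.ℓ + T.m) with T.row j = T.row i ∧ j < i, T.len (T.perm j)

/-- The component containing `I_a`. -/
def comp (a : A) : Bool := T.row (T.perm.symm a)

/-- The left endpoint of `I_a`. -/
def start (a : A) : ℝ := T.leftEnd (T.perm.symm a)

/-- The open interval `I_a`, inside its component. -/
def interval (a : A) : Set (ℝ × Bool) :=
  Set.Ioo (T.start a) (T.start a + T.len a) ×ˢ {T.comp a}

/-- The set `Σ` of division points: the left endpoints of the intervals that are not the
first one of their component. -/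
def divisionPoints : Set (ℝ × Bool) :=
  {z | ∃ i j : Fin (T.ℓ + T.m), T.row j = T.row i ∧ j < i ∧ z = (T.leftEnd i, T.row i)}

/-- The translation or the symmetry from `I_a` onto `I_{θ a}`. -/
def move (a : A) (z : ℝ × Bool) : ℝ × Bool :=
  (if T.flip a then T.start (θ a) + T.len (θ a) - (z.1 - T.start a)
    else T.start (θ a) + (z.1 - T.start a), T.comp (θ a))

open Classical in
/-- The first involution `σ₁`, meaningful on `Î ∖ Σ`, that is on the union of the `I_a`
(extended by the identity elsewhere). -/
noncomputable def sigma1 (z : ℝ × Bool) : ℝ × Bool :=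
  if h : ∃ a, z ∈ T.interval a then T.move h.choose z else z

/-- The second involution `σ₂`, which exchanges the two components. -/
def sigma2 (z : ℝ × Bool) : ℝ × Bool := (z.1, !z.2)

/-- The map `T = σ₂ ∘ σ₁`, meaningful on `Î ∖ Σ`. -/
noncomputable def map (z : ℝ × Bool) : ℝ × Bool := sigma2 (T.sigma1 z)

/-- The domain `Î ∖ Σ` of `T`. -/
def domain : Set (ℝ × Bool) := T.space \ T.divisionPoints

/-- `(T^n) z` is defined and equal to `y`, for the partial map `T` with domain `Î ∖ Σ`. -/
def IterEq (n : ℕ) (z y : ℝ × Bool) : Prop :=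
  (∀ i < n, T.map^[i] z ∈ T.domain) ∧ T.map^[n] z = y

/-- A connection: `(x, y, n)` with `x ∈ σ₂(Σ)` (a singularity of `T⁻¹`), `y ∈ Σ` (a singularity
of `T`), `n ≥ 0` and `T^n x = y`. -/
def IsConnection (x y : ℝ × Bool) (n : ℕ) : Prop :=
  x ∈ sigma2 '' T.divisionPoints ∧ y ∈ T.divisionPoints ∧ T.IterEq n x y

/-- The linear involution has no connections. -/
def WithoutConnections : Prop := ∀ x y n, ¬ T.IsConnection x y n

/-- The negative orbit `O = ⋃_{n ≥ 0} T^{-n}(Σ)` of the singular points. -/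
def negOrbit : Set (ℝ × Bool) :=
  {z | z ∈ T.space ∧ ∃ n, ∃ y ∈ T.divisionPoints, T.IterEq n z y}

/-- The closure `Ô = O ∪ σ₂(O)` of `O` under mirror image. -/
def negOrbitHat : Set (ℝ × Bool) := T.negOrbit ∪ sigma2 '' T.negOrbit

/-- The infinite word `u` is the infinite natural coding of `T` relative to `z ∈ Î ∖ Ô`:
`uₙ = a` if `T^n z ∈ I_a`. -/
def IsNaturalCoding (z : ℝ × Bool) (u : ℕ → A) : Prop :=
  z ∈ T.space \ T.negOrbitHat ∧ ∀ n, T.map^[n] z ∈ T.interval (u n)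

/-- The natural coding `𝓛(T)` of `T`: the set of factors of the infinite natural codings. -/
def language : Set (List A) :=
  {w | ∃ z u, T.IsNaturalCoding z u ∧
    ∃ p n : ℕ, w = (List.range n).map (fun i => u (p + i))}

end LinearInvolution

/-! ### Two criteria for graphs whose vertices are represented by sets -/

/-! A word lies in the language iff its cylinder is nonempty: cylinders are open, and the
exceptional set `negOrbitHat` is countable (`mem_language_iff`). So `ℰ(w)` is an intersection graph.
A left extension `a` is represented by `T(I_a)`, the mirror image of `I_{θ a}`, and a right
extension `b` by the cylinder of `wb`. Sets on the same side are disjoint, and sets on opposite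
sides meet exactly when `awb` is in the language.

Each of these sets is an interval inside one row of `Î`. Intervals of a linear order whose
intersection graph has no triangle form a forest, so every `ℰ(w)` is acyclic, with or without
connections.

The absence of connections gives connectedness. A point of the cylinder of `w` missed by all these
sets would lie in `σ₂(Σ)` and be sent into `Σ` by `T^|w|`. The sets are therefore an open cover of
the cylinder, and each of its rows, being an interval, gives one component: one row if `w` is
nonempty, two if `w` is empty.

Reducedness holds because `T` sends `I_a` to the row opposite to `I_{θ a}`. Closure under inverses
holds because `σ₂ ∘ T^n` reverses orbits. -/

theorem SimpleGraph.isAcyclic_of_ordConnected {V L : Type*} [LinearOrder L] (G : SimpleGraph V)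
    (O : V → Set L) (hO : ∀ v, (O v).OrdConnected)
    (hadj : ∀ v w, G.Adj v w → (O v ∩ O w).Nonempty)
    (hdisj : ∀ u v w, G.Adj u v → G.Adj v w → u ≠ w → Disjoint (O u) (O w)) :
    G.IsAcyclic := by
  intro r c hc
  have hne : c.toSubgraph.neighborSet r ≠ ∅ := fun h => by
    have := hc.ncard_neighborSet_toSubgraph_eq_two (v := r) (by simp)
    simp [h] at this
  obtain ⟨s, hs⟩ := Set.nonempty_iff_ne_empty.2 hne
  -- `q` is only a default value for pairs that are not edges, as `L` need not be inhabited.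
  obtain ⟨q, -⟩ := hadj _ _ (c.toSubgraph.adj_sub hs)
  have hpt : ∀ e : V × V, ∃ x : L, G.Adj e.1 e.2 → x ∈ O e.1 ∩ O e.2 := fun e => by
    by_cases h : G.Adj e.1 e.2
    · obtain ⟨x, hx⟩ := hadj _ _ h
      exact ⟨x, fun _ => hx⟩
    · exact ⟨q, fun h' => absurd h' h⟩
  choose p hp using hpt
  have hfin : {e : V × V | c.toSubgraph.Adj e.1 e.2}.Finite := by
    refine ((c.support.finite_toSet).prod (c.support.finite_toSet)).subset ?_
    rintro ⟨a, b⟩ h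
    exact ⟨c.mem_verts_toSubgraph.1 (c.toSubgraph.edge_vert h),
      c.mem_verts_toSubgraph.1 (c.toSubgraph.edge_vert h.symm)⟩
  -- Take the edge of the cycle whose common point is rightmost, and look at the next edge of the
  -- cycle at each of its two ends.
  obtain ⟨⟨a, b⟩, hab, hmax⟩ := Set.exists_max_image _ p hfin ⟨(r, s), hs⟩
  have other : ∀ a b, c.toSubgraph.Adj a b → ∃ b', b' ≠ b ∧ c.toSubgraph.Adj a b' := by
    intro a b h
    have h2 := hc.ncard_neighborSet_toSubgraph_eq_two (v := a)
      (c.mem_verts_toSubgraph.1 (c.toSubgraph.edge_vert h))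
    obtain ⟨b', hb', hne⟩ := Set.exists_ne_of_one_lt_ncard (h2 ▸ one_lt_two) b
    exact ⟨b', hne, hb'⟩
  obtain ⟨b', hb', hab'⟩ := other a b hab
  obtain ⟨a', ha', hba'⟩ := other b a hab.symm
  have gab := c.toSubgraph.adj_sub hab
  have gab' := c.toSubgraph.adj_sub hab'
  have gba' := c.toSubgraph.adj_sub hba'
  have hm := hp (a, b) gab
  have hy := hp (a, b') gab'
  have hx := hp (a', b) gba'.symm
  have hym := hmax (a, b') hab'
  have hxm := hmax (a', b) hba'.symm
  -- The larger of the two neighbouring points lies between two points of the same set `O b` or `O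
  -- a`, hence in it, and so in two sets that should be disjoint.
  rcases le_total (p (a', b)) (p (a, b')) with h | h
  · exact Set.disjoint_left.1 (hdisj b' a b gab'.symm gab hb') hy.2
      ((hO b).out hx.2 hm.2 ⟨h, hym⟩)
  · exact Set.disjoint_left.1 (hdisj a' b a gba'.symm gab.symm ha') hx.1
      ((hO a).out hy.1 hm.1 ⟨h, hxm⟩)

/-- Otherwise the sets of the vertices reachable from `v` and those of the others would have open
unions that separate `C`. -/
theorem SimpleGraph.reachable_of_isPreconnected {V X : Type*} [TopologicalSpace X]
    (G : SimpleGraph V) {C : Set X} (hC : IsPreconnected C) (O : V → Set X)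
    (hO : ∀ v, IsOpen (O v)) (hcov : ∀ x ∈ C, ∃ v, x ∈ O v)
    (hadj : ∀ v w, (C ∩ (O v ∩ O w)).Nonempty → G.Reachable v w)
    {v w : V} (hv : (C ∩ O v).Nonempty) (hw : (C ∩ O w).Nonempty) : G.Reachable v w := by
  by_contra hvw
  obtain ⟨x, hxC, hx, hx'⟩ := hC (⋃ u ∈ {u | G.Reachable v u}, O u)
    (⋃ u ∈ {u | ¬ G.Reachable v u}, O u)
    (isOpen_biUnion fun u _ => hO u) (isOpen_biUnion fun u _ => hO u)
    (fun x hx => by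
      obtain ⟨u, hu⟩ := hcov x hx
      by_cases h : G.Reachable v u
      · exact Or.inl (Set.mem_biUnion (show u ∈ {u | G.Reachable v u} from h) hu)
      · exact Or.inr (Set.mem_biUnion (show u ∈ {u | ¬ G.Reachable v u} from h) hu))
    (hv.mono (Set.inter_subset_inter_right _
      (Set.subset_biUnion_of_mem (u := O) (SimpleGraph.Reachable.refl v))))
    (hw.mono (Set.inter_subset_inter_right _
      (Set.subset_biUnion_of_mem (u := O) (show w ∈ {u | ¬ G.Reachable v u} from hvw))))
  simp only [Set.mem_iUnion, Set.mem_ofPred_eq] at hx hx'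
  obtain ⟨u, hu, hxu⟩ := hx
  obtain ⟨u', hu', hxu'⟩ := hx'
  exact hu' (hu.trans (hadj u u' ⟨x, hxC, hxu, hxu'⟩))

namespace LinearInvolution

variable {A : Type*} {θ : A → A} (T : LinearInvolution A θ)

/-! ### The partition of `Î` into the intervals `I_a` and the division points -/

theorem sum_row (δ : Bool) :
    ∑ i : Fin (T.ℓ + T.m) with T.row i = δ, T.len (T.perm i) = T.right - T.left := by
  rw [Finset.sum_filter, Fin.sum_univ_add]
  cases δ
  · rw [← T.sum_top]
    simp [row]
  · rw [← T.sum_bot]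
    simp [row, fun x : Fin T.ℓ => x.2.not_ge]

theorem left_le_leftEnd (i : Fin (T.ℓ + T.m)) : T.left ≤ T.leftEnd i :=
  le_add_of_nonneg_right (Finset.sum_nonneg fun _ _ => (T.len_pos _).le)

theorem leftEnd_add_len (i : Fin (T.ℓ + T.m)) :
    T.leftEnd i + T.len (T.perm i) =
      T.left + ∑ j : Fin (T.ℓ + T.m) with T.row j = T.row i ∧ j ≤ i, T.len (T.perm j) := by
  have : (Finset.univ.filter fun j => T.row j = T.row i ∧ j ≤ i) =
      insert i (Finset.univ.filter fun j => T.row j = T.row i ∧ j < i) := by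
    ext j
    simp only [Finset.mem_filter, Finset.mem_univ, true_and, Finset.mem_insert, le_iff_eq_or_lt]
    constructor
    · tauto
    · rintro (rfl | h) <;> tauto
  rw [this, Finset.sum_insert (by simp), leftEnd]
  ring

theorem leftEnd_add_len_le_leftEnd {i j : Fin (T.ℓ + T.m)} (h : T.row j = T.row i) (hji : j < i) :
    T.leftEnd j + T.len (T.perm j) ≤ T.leftEnd i := by
  rw [leftEnd_add_len, leftEnd, add_le_add_iff_left]
  refine Finset.sum_le_sum_of_subset_of_nonneg ?_ fun _ _ _ => (T.len_pos _).le
  intro k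
  simp only [Finset.mem_filter, Finset.mem_univ, true_and]
  exact fun hk => ⟨hk.1.trans h, hk.2.trans_lt hji⟩

theorem leftEnd_add_len_le_right (i : Fin (T.ℓ + T.m)) :
    T.leftEnd i + T.len (T.perm i) ≤ T.right := by
  rw [leftEnd_add_len, ← le_sub_iff_add_le', ← T.sum_row (T.row i)]
  refine Finset.sum_le_sum_of_subset_of_nonneg ?_ fun _ _ _ => (T.len_pos _).le
  intro k
  simp only [Finset.mem_filter, Finset.mem_univ, true_and]
  exact fun hk => hk.1

theorem exists_leftEnd_le_lt {x : ℝ} (hx : x ∈ Set.Ioo T.left T.right) (δ : Bool) :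
    ∃ i, T.row i = δ ∧ T.leftEnd i ≤ x ∧ x < T.leftEnd i + T.len (T.perm i) := by
  have hrow : (Finset.univ.filter fun i => T.row i = δ).Nonempty := by
    rw [Finset.nonempty_iff_ne_empty]
    intro h
    have := T.sum_row δ
    rw [h, Finset.sum_empty] at this
    linarith [T.left_lt_right]
  have hfirst : (Finset.univ.filter fun i => T.row i = δ ∧ T.leftEnd i ≤ x).Nonempty := by
    obtain ⟨i, hi, hmin⟩ := Finset.exists_min_image _ id hrow
    simp only [Finset.mem_filter, Finset.mem_univ, true_and, id] at hi hmin
    refine ⟨i, Finset.mem_filter.2 ⟨Finset.mem_univ _, hi, ?_⟩⟩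
    rw [leftEnd, Finset.sum_eq_zero, add_zero]
    · exact hx.1.le
    · intro j hj
      simp only [Finset.mem_filter, Finset.mem_univ, true_and] at hj
      exact absurd (hmin j (hj.1.trans hi)) hj.2.not_ge
  obtain ⟨i, hi, hmax⟩ := Finset.exists_max_image _ id hfirst
  simp only [Finset.mem_filter, Finset.mem_univ, true_and, id] at hi hmax
  refine ⟨i, hi.1, hi.2, lt_of_not_ge fun hle => ?_⟩
  rw [leftEnd_add_len] at hle
  -- If `x` is past the end of the `i`-th interval, either the next interval of the row starts at
  -- that end, against the maximality of `i`, or that end is `T.right`.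
  by_cases hlast : (Finset.univ.filter fun j => T.row j = δ ∧ i < j).Nonempty
  · obtain ⟨k, hk, hmin⟩ := Finset.exists_min_image _ id hlast
    simp only [Finset.mem_filter, Finset.mem_univ, true_and, id] at hk hmin
    refine absurd (hmax k ⟨hk.1, ?_⟩) hk.2.not_ge
    refine le_trans (le_of_eq ?_) hle
    rw [leftEnd, hk.1, hi.1]
    congr 2
    ext j
    simp only [Finset.mem_filter, Finset.mem_univ, true_and, and_congr_right_iff]
    intro hj
    constructor
    · exact fun h => le_of_not_gt fun h' => (hmin j ⟨hj, h'⟩).not_gt h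
    · exact fun h => h.trans_lt hk.2
  · refine absurd hle (not_le.2 (hx.2.trans_le (le_of_eq ?_)))
    rw [← sub_eq_iff_eq_add', ← T.sum_row δ, hi.1]
    congr 1
    ext j
    simp only [Finset.mem_filter, Finset.mem_univ, true_and, iff_self_and]
    intro hj
    by_contra h
    exact hlast ⟨j, by simpa using ⟨hj, not_le.1 h⟩⟩

theorem interval_subset_space (a : A) : T.interval a ⊆ T.space := by
  rintro ⟨x, δ⟩ ⟨hx, -⟩
  have h2 := T.leftEnd_add_len_le_right (T.perm.symm a)
  rw [Equiv.apply_symm_apply] at h2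
  exact ⟨⟨(T.left_le_leftEnd _).trans_lt hx.1, hx.2.trans_le h2⟩, trivial⟩

theorem eq_of_mem_interval {a b : A} {z : ℝ × Bool} (ha : z ∈ T.interval a)
    (hb : z ∈ T.interval b) : a = b := by
  have key : ∀ {a b : A}, z ∈ T.interval a → z ∈ T.interval b →
      ¬ T.perm.symm a < T.perm.symm b := by
    intro a b ha hb h
    have := T.leftEnd_add_len_le_leftEnd (ha.2.symm.trans hb.2) h
    rw [Equiv.apply_symm_apply] at this
    exact absurd (ha.1.2.trans_le this) hb.1.1.not_gt
  exact T.perm.symm.injective (le_antisymm (not_lt.1 (key hb ha)) (not_lt.1 (key ha hb)))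

theorem divisionPoints_subset_space : T.divisionPoints ⊆ T.space := by
  rintro _ ⟨i, j, hr, hji, rfl⟩
  refine ⟨⟨?_, ?_⟩, trivial⟩
  · linarith [T.left_le_leftEnd j, T.len_pos (T.perm j), T.leftEnd_add_len_le_leftEnd hr hji]
  · linarith [T.leftEnd_add_len_le_right i, T.len_pos (T.perm i)]

theorem interval_subset_domain (a : A) : T.interval a ⊆ T.domain := by
  refine fun z hz => ⟨T.interval_subset_space a hz, ?_⟩
  rintro ⟨i, j, -, -, rfl⟩
  have hr : T.row i = T.row (T.perm.symm a) := hz.2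
  have h1 : T.leftEnd (T.perm.symm a) < T.leftEnd i := hz.1.1
  have h2 : T.leftEnd i < T.leftEnd (T.perm.symm a) + T.len a := hz.1.2
  rcases lt_trichotomy i (T.perm.symm a) with h | h | h
  · linarith [T.leftEnd_add_len_le_leftEnd hr h, T.len_pos (T.perm i)]
  · rw [h] at h1
    exact lt_irrefl _ h1
  · have := T.leftEnd_add_len_le_leftEnd hr.symm h
    rw [Equiv.apply_symm_apply] at this
    linarith

theorem exists_mem_interval {z : ℝ × Bool} (hz : z ∈ T.domain) : ∃ a, z ∈ T.interval a := by
  obtain ⟨⟨hx, -⟩, hd⟩ := hz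
  obtain ⟨i, hi, h1, h2⟩ := T.exists_leftEnd_le_lt hx z.2
  rcases h1.lt_or_eq with h1 | h1
  · refine ⟨T.perm i, ⟨?_, ?_⟩, ?_⟩
    · simpa [start] using h1
    · simpa [start] using h2
    · simpa [comp] using hi.symm
  · refine absurd ?_ hd
    -- A left endpoint is a division point unless its interval is first in its row; then it is
    -- `T.left`, which is not in the open interval.
    by_cases hj : ∃ j, T.row j = T.row i ∧ j < i
    · obtain ⟨j, hj⟩ := hj
      exact ⟨i, j, hj.1, hj.2, Prod.ext h1.symm hi.symm⟩
    · refine absurd h1 (ne_of_lt ?_)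
      rw [leftEnd, Finset.sum_eq_zero, add_zero]
      · exact hx.1
      · intro j h
        simp only [Finset.mem_filter, Finset.mem_univ, true_and] at h
        exact absurd ⟨j, h⟩ hj

theorem countable_divisionPoints : T.divisionPoints.Countable := by
  refine (Set.countable_range fun i => (T.leftEnd i, T.row i)).mono ?_
  rintro _ ⟨i, j, -, -, rfl⟩
  exact ⟨i, rfl⟩

/-! ### The maps `σ₁`, `σ₂` and `T` -/

@[simp] theorem sigma2_sigma2 (z : ℝ × Bool) : sigma2 (sigma2 z) = z := by
  simp [sigma2]

theorem sigma2_mem_space {z : ℝ × Bool} (hz : z ∈ T.space) : sigma2 z ∈ T.space :=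
  ⟨hz.1, trivial⟩

theorem sigma1_of_mem {a : A} {z : ℝ × Bool} (hz : z ∈ T.interval a) :
    T.sigma1 z = T.move a z := by
  have h : ∃ a, z ∈ T.interval a := ⟨a, hz⟩
  rw [sigma1, dif_pos h, T.eq_of_mem_interval h.choose_spec hz]

theorem map_of_mem {a : A} {z : ℝ × Bool} (hz : z ∈ T.interval a) :
    T.map z = sigma2 (T.move a z) := by
  rw [map, sigma1_of_mem T hz]

theorem move_mem_interval {a : A} {z : ℝ × Bool} (hz : z ∈ T.interval a) :
    T.move a z ∈ T.interval (θ a) := by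
  obtain ⟨⟨h1, h2⟩, -⟩ := hz
  have := T.len_inv a
  refine ⟨?_, rfl⟩
  simp only [move, Set.mem_Ioo]
  split_ifs <;> constructor <;> linarith

theorem sigma1_mem_interval {a : A} {z : ℝ × Bool} (hz : z ∈ T.interval a) :
    T.sigma1 z ∈ T.interval (θ a) := by
  rw [sigma1_of_mem T hz]
  exact T.move_mem_interval hz

theorem sigma1_sigma1 (hθ : Function.Involutive θ) {a : A} {z : ℝ × Bool}
    (hz : z ∈ T.interval a) : T.sigma1 (T.sigma1 z) = z := by
  rw [sigma1_of_mem T hz, sigma1_of_mem T (T.move_mem_interval hz)]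
  obtain ⟨-, hc⟩ := hz
  have hl := T.len_inv a
  refine Prod.ext ?_ ?_
  · simp only [move, T.flip_inv, hθ a]
    split_ifs <;> linarith
  · simpa [move, hθ a] using hc.symm

/-- The image of `I_a` under `T`, which is the mirror image of `I_{θ a}`. -/
def mirror (a : A) : Set (ℝ × Bool) := {y | sigma2 y ∈ T.interval (θ a)}

theorem map_mem_mirror {a : A} {z : ℝ × Bool} (hz : z ∈ T.interval a) : T.map z ∈ T.mirror a := by
  simpa [mirror, map] using T.sigma1_mem_interval hz

theorem mirror_subset_space (a : A) : T.mirror a ⊆ T.space := fun z hz => by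
  have := T.sigma2_mem_space (T.interval_subset_space _ hz)
  rwa [sigma2_sigma2] at this

theorem exists_map_eq (hθ : Function.Involutive θ) {a : A} {y : ℝ × Bool}
    (hy : y ∈ T.mirror a) : ∃ z ∈ T.interval a, T.map z = y := by
  refine ⟨T.sigma1 (sigma2 y), ?_, ?_⟩
  · have := T.sigma1_mem_interval hy
    rwa [hθ a] at this
  · rw [map, T.sigma1_sigma1 hθ hy, sigma2_sigma2]

theorem eq_of_mem_mirror (hθ : Function.Involutive θ) {a b : A} {z : ℝ × Bool}
    (ha : z ∈ T.mirror a) (hb : z ∈ T.mirror b) : a = b :=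
  hθ.injective (T.eq_of_mem_interval ha hb)

theorem exists_mem_mirror (hθ : Function.Involutive θ) {z : ℝ × Bool} (hz : z ∈ T.space)
    (hd : z ∉ sigma2 '' T.divisionPoints) : ∃ a, z ∈ T.mirror a := by
  obtain ⟨b, hb⟩ := T.exists_mem_interval (z := sigma2 z)
    ⟨T.sigma2_mem_space hz, fun h => hd ⟨_, h, sigma2_sigma2 z⟩⟩
  exact ⟨θ b, by rwa [mirror, hθ b]⟩

theorem map_mem_space {z : ℝ × Bool} (hz : z ∈ T.domain) : T.map z ∈ T.space := by
  obtain ⟨a, ha⟩ := T.exists_mem_interval hz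
  exact T.mirror_subset_space a (T.map_mem_mirror ha)

theorem map_injOn_domain (hθ : Function.Involutive θ) : Set.InjOn T.map T.domain := by
  intro z hz y hy h
  obtain ⟨a, ha⟩ := T.exists_mem_interval hz
  obtain ⟨b, hb⟩ := T.exists_mem_interval hy
  have h' : T.sigma1 z = T.sigma1 y := by
    simpa [map] using congrArg sigma2 h
  rw [← T.sigma1_sigma1 hθ ha, h', T.sigma1_sigma1 hθ hb]

/-! ### The singular orbits -/

/-- `T` is injective on its domain, so pulling back preserves countability. -/
theorem countable_iterEq (hθ : Function.Involutive θ) (n : ℕ) :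
    {z | ∃ y ∈ T.divisionPoints, T.IterEq n z y}.Countable := by
  induction n with
  | zero =>
    refine T.countable_divisionPoints.mono ?_
    rintro z ⟨y, hy, -, h⟩
    rw [Function.iterate_zero, id] at h
    exact h ▸ hy
  | succ n ih =>
    refine Set.MapsTo.countable_of_injOn (f := T.map) ?_ ((T.map_injOn_domain hθ).mono ?_) ih
    · rintro z ⟨y, hy, h1, h2⟩
      exact ⟨y, hy, fun i hi => h1 (i + 1) (by omega), h2⟩
    · rintro z ⟨y, hy, h1, h2⟩
      exact h1 0 (by omega)

theorem countable_negOrbitHat (hθ : Function.Involutive θ) : T.negOrbitHat.Countable := by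
  have h : T.negOrbit.Countable := by
    refine (Set.countable_iUnion fun n => T.countable_iterEq hθ n).mono ?_
    rintro z ⟨-, n, hn⟩
    exact Set.mem_iUnion.2 ⟨n, hn⟩
  exact h.union (h.image _)

/-- On a horizontal line, the complement of a countable set is dense. -/
theorem exists_notMem_negOrbitHat (hθ : Function.Involutive θ) {U : Set (ℝ × Bool)}
    (hU : IsOpen U) (hne : U.Nonempty) : ∃ z ∈ U, z ∉ T.negOrbitHat := by
  obtain ⟨⟨x, δ⟩, hx⟩ := hne
  have hc : ((fun t : ℝ => (t, δ)) ⁻¹' T.negOrbitHat).Countable :=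
    (T.countable_negOrbitHat hθ).preimage fun s t h => congrArg Prod.fst h
  obtain ⟨t, ht, ht'⟩ := (hc.dense_compl ℝ).inter_open_nonempty
    ((fun t : ℝ => (t, δ)) ⁻¹' U) (hU.preimage (by fun_prop)) ⟨x, hx⟩
  exact ⟨(t, δ), ht, ht'⟩

theorem iterate_mem_domain {z : ℝ × Bool} (hz : z ∈ T.space) (h : z ∉ T.negOrbit) (n : ℕ) :
    T.map^[n] z ∈ T.domain := by
  induction n using Nat.strong_induction_on with
  | _ n ih =>
    refine ⟨?_, fun hd => h ⟨hz, n, _, hd, ih, rfl⟩⟩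
    cases n with
    | zero => exact hz
    | succ n =>
      rw [Function.iterate_succ_apply']
      exact T.map_mem_space (ih n (by omega))

theorem divisionPoints_subset_negOrbit : T.divisionPoints ⊆ T.negOrbit := fun z hz =>
  ⟨T.divisionPoints_subset_space hz, 0, z, hz, fun i hi => absurd hi (by omega), rfl⟩

/-! ### Cylinders -/

/-- The set of the points `z` of `Î` such that `T^i z` belongs to `I_a` for `a` the letter of
index `i` of the word `w`. -/
def cylinder : List A → Set (ℝ × Bool)
  | [] => T.space
  | a :: w => T.interval a ∩ T.map ⁻¹' cylinder w

theorem cylinder_subset_space (w : List A) : T.cylinder w ⊆ T.space := by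
  cases w with
  | nil => exact subset_rfl
  | cons a w => exact fun z hz => T.interval_subset_space a hz.1

theorem iterate_mem_space_of_mem_cylinder {w : List A} {z : ℝ × Bool} (hz : z ∈ T.cylinder w) :
    T.map^[w.length] z ∈ T.space := by
  induction w generalizing z with
  | nil => exact hz
  | cons a w ih => exact ih hz.2

theorem iterate_mem_domain_of_mem_cylinder {w : List A} {z : ℝ × Bool} (hz : z ∈ T.cylinder w) :
    ∀ i < w.length, T.map^[i] z ∈ T.domain := by
  induction w generalizing z with
  | nil => exact fun i hi => absurd hi (by simp)
  | cons a w ih =>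
    intro i hi
    cases i with
    | zero => exact T.interval_subset_domain a hz.1
    | succ i => exact ih hz.2 i (by simpa using hi)

theorem mem_cylinder_append_singleton {w : List A} {b : A} {z : ℝ × Bool} :
    z ∈ T.cylinder (w ++ [b]) ↔ z ∈ T.cylinder w ∧ T.map^[w.length] z ∈ T.interval b := by
  induction w generalizing z with
  | nil =>
    exact ⟨fun h => ⟨T.interval_subset_space b h.1, h.1⟩, fun h =>
      ⟨h.2, T.map_mem_space (T.interval_subset_domain b h.2)⟩⟩
  | cons a w ih =>
    change (z ∈ T.interval a ∧ T.map z ∈ T.cylinder (w ++ [b])) ↔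
      (z ∈ T.interval a ∧ T.map z ∈ T.cylinder w) ∧ T.map^[w.length] (T.map z) ∈ T.interval b
    rw [ih, and_assoc]

theorem isOpen_space : IsOpen T.space := isOpen_Ioo.prod isOpen_univ

theorem isOpen_interval (a : A) : IsOpen (T.interval a) := isOpen_Ioo.prod (isOpen_discrete _)

theorem continuous_sigma2 : Continuous sigma2 := by
  unfold sigma2
  exact continuous_fst.prodMk ((continuous_of_discreteTopology (f := Bool.not)).comp continuous_snd)

theorem continuous_move (a : A) : Continuous (T.move a) := by
  unfold move
  split_ifs <;> fun_prop

theorem isOpen_mirror (a : A) : IsOpen (T.mirror a) :=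
  (T.isOpen_interval _).preimage continuous_sigma2

theorem isOpen_cylinder (w : List A) : IsOpen (T.cylinder w) := by
  induction w with
  | nil => exact T.isOpen_space
  | cons a w ih =>
    -- `T` is not globally continuous, but on `I_a` it agrees with the continuous map `σ₂ ∘ move a`.
    have : T.cylinder (a :: w) =
        T.interval a ∩ (fun z => sigma2 (T.move a z)) ⁻¹' T.cylinder w := by
      ext z
      refine and_congr_right fun hz => ?_
      rw [Set.mem_preimage, Set.mem_preimage, T.map_of_mem hz]
    rw [this]
    exact (T.isOpen_interval a).inter
      (ih.preimage (continuous_sigma2.comp (T.continuous_move a)))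

theorem ordConnected_cylinder_slice (w : List A) (δ : Bool) :
    {t : ℝ | (t, δ) ∈ T.cylinder w}.OrdConnected := by
  induction w generalizing δ with
  | nil =>
    have : {t : ℝ | (t, δ) ∈ T.cylinder []} = Set.Ioo T.left T.right := by
      ext t
      exact and_iff_left trivial
    rw [this]
    exact Set.ordConnected_Ioo
  | cons a w ih =>
    refine ⟨?_⟩
    rintro s ⟨hs, hs'⟩ r ⟨hr, hr'⟩ t ht
    have hta : (t, δ) ∈ T.interval a :=
      ⟨⟨hs.1.1.trans_le ht.1, ht.2.trans_lt hr.1.2⟩, hs.2⟩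
    refine ⟨hta, ?_⟩
    rw [Set.mem_preimage, T.map_of_mem ‹_›] at hs' hr' ⊢
    simp only [sigma2, move] at hs' hr' ⊢
    have h1 := ht.1
    have h2 := ht.2
    -- On `I_a` the map is affine of slope `-1` or `1`; a symmetry exchanges the roles of the two
    -- endpoints.
    split_ifs at hs' hr' ⊢
    · exact (ih _).out hr' hs' ⟨by linarith, by linarith⟩
    · exact (ih _).out hs' hr' ⟨by linarith, by linarith⟩

theorem isPreconnected_cylinder_row (w : List A) (δ : Bool) :
    IsPreconnected (T.cylinder w ∩ {z | z.2 = δ}) := by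
  have : T.cylinder w ∩ {z | z.2 = δ} = {t : ℝ | (t, δ) ∈ T.cylinder w} ×ˢ {δ} := by
    ext ⟨t, ε⟩
    simp only [Set.mem_inter_iff, Set.mem_ofPred_eq, Set.mem_prod, Set.mem_singleton_iff]
    constructor <;> rintro ⟨h, rfl⟩ <;> exact ⟨h, rfl⟩
  rw [this]
  exact (T.ordConnected_cylinder_slice w δ).isPreconnected.prod isPreconnected_singleton

/-- The row of a nonempty cylinder set of a nonempty word is that of its first letter. -/
theorem snd_eq_of_mem_cylinder_append {w : List A} {b : A} {z y : ℝ × Bool}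
    (hz : z ∈ T.cylinder (w ++ [b])) (hy : y ∈ T.cylinder (w ++ [b])) : z.2 = y.2 := by
  cases w with
  | nil => exact hz.1.2.trans hy.1.2.symm
  | cons a w => exact hz.1.2.trans hy.1.2.symm

theorem snd_eq_of_mem_mirror {a : A} {z y : ℝ × Bool}
    (hz : z ∈ T.mirror a) (hy : y ∈ T.mirror a) : z.2 = y.2 :=
  Bool.not_inj (hz.2.trans hy.2.symm)

/-- The lexicographic order puts one row entirely before the other, making `Î` part of a single
linear order to which the acyclicity criterion applies. -/
theorem _root_.ordConnected_lex_of_slice {C : Set (ℝ × Bool)}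
    (hC : ∀ z ∈ C, ∀ y ∈ C, z.2 = y.2) (hslice : ∀ δ, {t : ℝ | (t, δ) ∈ C}.OrdConnected) :
    {l : Bool ×ₗ ℝ | ((ofLex l).2, (ofLex l).1) ∈ C}.OrdConnected := by
  refine ⟨fun x hx y hy z hz => ?_⟩
  have hxy : (ofLex x).1 = (ofLex y).1 := hC _ hx _ hy
  obtain ⟨h1, h2⟩ := hz
  have hle1 : (ofLex x).1 ≤ (ofLex z).1 := by
    rcases Prod.Lex.le_iff.1 h1 with h | h
    · exact h.le
    · exact h.1.le
  have hle2 : (ofLex z).1 ≤ (ofLex y).1 := by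
    rcases Prod.Lex.le_iff.1 h2 with h | h
    · exact h.le
    · exact h.1.le
  have hxz : (ofLex x).1 = (ofLex z).1 := le_antisymm hle1 (hle2.trans hxy.ge)
  have hzy : (ofLex z).1 = (ofLex y).1 := hxz.symm.trans hxy
  have h1' : (ofLex x).2 ≤ (ofLex z).2 := by
    rcases Prod.Lex.le_iff.1 h1 with h | h
    · exact absurd hxz h.ne
    · exact h.2
  have h2' : (ofLex z).2 ≤ (ofLex y).2 := by
    rcases Prod.Lex.le_iff.1 h2 with h | h
    · exact absurd hzy h.ne
    · exact h.2
  refine (hslice (ofLex z).1).out (x := (ofLex x).2) (y := (ofLex y).2) ?_ ?_ ⟨h1', h2'⟩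
  · exact hxz ▸ hx
  · exact hzy ▸ hy

theorem ordConnected_mirror_slice (a : A) (δ : Bool) :
    {t : ℝ | (t, δ) ∈ T.mirror a}.OrdConnected :=
  ⟨fun _ hs _ hr _ ht => ⟨⟨hs.1.1.trans_le ht.1, ht.2.trans_lt hr.1.2⟩, hs.2⟩⟩

/-! ### The language -/

theorem mem_cylinder_of_coding {u : ℕ → A} {z : ℝ × Bool} (hz : z ∈ T.space)
    (h : ∀ n, T.map^[n] z ∈ T.interval (u n)) (n : ℕ) :
    z ∈ T.cylinder ((List.range n).map u) := by
  induction n with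
  | zero => exact hz
  | succ n ih =>
    rw [List.range_succ, List.map_append]
    exact T.mem_cylinder_append_singleton.2 ⟨ih, by simpa using h n⟩

theorem eq_of_mem_cylinder {w v : List A} {z : ℝ × Bool} (hw : z ∈ T.cylinder w)
    (hv : z ∈ T.cylinder v) (h : w.length = v.length) : w = v := by
  induction w generalizing v z with
  | nil => exact (List.length_eq_zero_iff.1 h.symm).symm
  | cons a w ih =>
    cases v with
    | nil => simp at h
    | cons b v => rw [T.eq_of_mem_interval hw.1 hv.1, ih hw.2 hv.2 (by simpa using h)]

theorem mem_language_iff (hθ : Function.Involutive θ) {w : List A} :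
    w ∈ T.language ↔ (T.cylinder w).Nonempty := by
  constructor
  · rintro ⟨z, u, ⟨hz, hu⟩, p, n, rfl⟩
    refine ⟨T.map^[p] z, T.mem_cylinder_of_coding (T.interval_subset_space _ (hu p)) ?_ n⟩
    intro i
    rw [← Function.iterate_add_apply, add_comm i p]
    exact hu (p + i)
  · intro h
    obtain ⟨z, hz, hz'⟩ := T.exists_notMem_negOrbitHat hθ (T.isOpen_cylinder w) h
    have hs := T.cylinder_subset_space w hz
    choose u hu using fun n =>
      T.exists_mem_interval (T.iterate_mem_domain hs (fun h => hz' (Or.inl h)) n)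
    refine ⟨z, u, ⟨⟨hs, hz'⟩, hu⟩, 0, w.length,
      T.eq_of_mem_cylinder hz (T.mem_cylinder_of_coding hs ?_ _) (by simp)⟩
    simpa using hu

/-- `T` maps `I_a` onto `mirror a`, so the cylinder of `aw` has image `mirror a ∩ cylinder w`. This
moves left extensions into the cylinder of `w`. -/
theorem cons_mem_language_iff (hθ : Function.Involutive θ) {a : A} {w : List A} :
    a :: w ∈ T.language ↔ (T.mirror a ∩ T.cylinder w).Nonempty := by
  rw [T.mem_language_iff hθ]
  constructor
  · rintro ⟨z, h1, h2⟩
    exact ⟨T.map z, T.map_mem_mirror h1, h2⟩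
  · rintro ⟨y, h1, h2⟩
    obtain ⟨z, hz, rfl⟩ := T.exists_map_eq hθ h1
    exact ⟨z, hz, h2⟩

theorem nonempty_interval (a : A) : (T.interval a).Nonempty :=
  ⟨(T.start a + T.len a / 2, T.comp a),
    ⟨by linarith [T.len_pos a], by linarith [T.len_pos a]⟩, rfl⟩

theorem isFactorialSet_language (hθ : Function.Involutive θ) : IsFactorialSet T.language := by
  constructor
  · intro a
    obtain ⟨z, hz⟩ := T.nonempty_interval a
    exact (T.mem_language_iff hθ).2 ⟨z, hz, T.map_mem_space (T.interval_subset_domain a hz)⟩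
  · rintro _ ⟨z, u, hz, p, n, rfl⟩ v hv
    obtain ⟨s, t, h⟩ := hv
    have hlen := congrArg List.length h
    simp only [List.length_append, List.length_map, List.length_range] at hlen
    refine ⟨z, u, hz, p + s.length, v.length, ?_⟩
    refine List.ext_getElem (by simp) fun i h1 h2 => ?_
    have hget : (s ++ v ++ t)[s.length + i]'(by simp; omega) = v[i] := by
      rw [List.getElem_append_left (by simp; omega), List.getElem_append_right (by omega)]
      simp
    rw [← hget]
    simp only [h, List.getElem_map, List.getElem_range, add_assoc]

theorem isBiextendableSet_language (hθ : Function.Involutive θ) :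
    IsBiextendableSet T.language := by
  refine ⟨T.isFactorialSet_language hθ, fun w hw => ?_⟩
  -- Avoiding `O` gives the next letter; avoiding `σ₂(O)`, which contains `σ₂(Σ)`, gives the
  -- preceding one.
  obtain ⟨z, hz, hz'⟩ := T.exists_notMem_negOrbitHat hθ (T.isOpen_cylinder w)
    ((T.mem_language_iff hθ).1 hw)
  have hs := T.cylinder_subset_space w hz
  obtain ⟨a, ha⟩ := T.exists_mem_mirror hθ hs fun h =>
    hz' (Or.inr (Set.image_mono T.divisionPoints_subset_negOrbit h))
  obtain ⟨b, hb⟩ := T.exists_mem_interval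
    (T.iterate_mem_domain hs (fun h => hz' (Or.inl h)) w.length)
  exact ⟨a, b, (T.cons_mem_language_iff hθ).2 ⟨z, ha, T.mem_cylinder_append_singleton.2 ⟨hz, hb⟩⟩⟩

theorem isReducedWord_of_cylinder {w : List A} (hw : (T.cylinder w).Nonempty) :
    IsReducedWord θ w := by
  induction w with
  | nil => exact List.isChain_nil
  | cons a w ih =>
    obtain ⟨z, hza, hzw⟩ := hw
    cases w with
    | nil => exact List.isChain_singleton a
    | cons b w =>
      refine List.isChain_cons_cons.2 ⟨?_, ih ⟨_, hzw⟩⟩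
      rintro rfl
      have h1 : (T.map z).2 = T.comp (θ a) := hzw.1.2
      have h2 : (!(T.map z).2) = T.comp (θ a) := (T.map_mem_mirror hza).2
      exact absurd (h1.trans h2.symm) (by simp)

/-- Since `σ₁` and `σ₂` are involutions, `T σ₂ T = σ₂`: the mirrored endpoint of an orbit segment
retraces it backwards. The second conjunct, which locates the end of the return, carries the
induction. -/
theorem sigma2_iterate_mem_cylinder (hθ : Function.Involutive θ) {w : List A} {z : ℝ × Bool}
    (hz : z ∈ T.cylinder w) :
    sigma2 (T.map^[w.length] z) ∈ T.cylinder (inverseWord θ w) ∧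
      T.map^[w.length] (sigma2 (T.map^[w.length] z)) = sigma2 z := by
  induction w generalizing z with
  | nil => exact ⟨T.sigma2_mem_space hz, rfl⟩
  | cons a w ih =>
    obtain ⟨hza, hzw⟩ := hz
    obtain ⟨h1, h2⟩ := ih hzw
    have h3 : sigma2 (T.map z) = T.sigma1 z := sigma2_sigma2 _
    rw [h3] at h2
    have hinv : inverseWord θ (a :: w) = inverseWord θ w ++ [θ a] := by simp [inverseWord]
    have hlen : (inverseWord θ w).length = w.length := by simp [inverseWord]
    constructor
    · rw [hinv, mem_cylinder_append_singleton, hlen]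
      exact ⟨h1, h2.symm ▸ T.sigma1_mem_interval hza⟩
    · rw [List.length_cons, Function.iterate_succ_apply', Function.iterate_succ_apply, h2, map,
        T.sigma1_sigma1 hθ hza]

theorem isLaminarySet_language (hθ : Function.Involutive θ) : IsLaminarySet θ T.language := by
  refine ⟨T.isBiextendableSet_language hθ, fun w hw => ?_, fun w hw => ?_⟩
  · exact T.isReducedWord_of_cylinder ((T.mem_language_iff hθ).1 hw)
  · obtain ⟨z, hz⟩ := (T.mem_language_iff hθ).1 hw
    exact (T.mem_language_iff hθ).2 ⟨_, (T.sigma2_iterate_mem_cylinder hθ hz).1⟩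

/-! ### The extension graphs -/

/-- The set of points representing a vertex of an extension graph: the mirror image of `I_{θ a}`
for a left extension `a`, and the cylinder of `wb` for a right extension `b`. -/
def vertexSet (w : List A) :
    {a : A // a :: w ∈ T.language} ⊕ {b : A // w ++ [b] ∈ T.language} → Set (ℝ × Bool)
  | Sum.inl a => T.mirror a.1
  | Sum.inr b => T.cylinder (w ++ [b.1])

variable {T}

theorem nonempty_inter_of_adj (hθ : Function.Involutive θ) {w : List A} {x y}
    (h : (extensionGraph T.language w).Adj x y) :
    (T.vertexSet w x ∩ T.vertexSet w y).Nonempty := by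
  rcases x with a | b <;> rcases y with a' | b'
  · exact h.elim
  · exact (T.cons_mem_language_iff hθ).1 h
  · rw [Set.inter_comm]
    exact (T.cons_mem_language_iff hθ).1 h
  · exact h.elim

/-- Vertices on the same side have disjoint sets, so with `nonempty_inter_of_adj` the extension
graph is exactly the intersection graph of `vertexSet`. -/
theorem eq_or_adj_of_nonempty_inter (hθ : Function.Involutive θ) {w : List A} {x y}
    (h : (T.vertexSet w x ∩ T.vertexSet w y).Nonempty) :
    x = y ∨ (extensionGraph T.language w).Adj x y := by
  rcases x with a | b <;> rcases y with a' | b'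
  · obtain ⟨z, h1, h2⟩ := h
    exact Or.inl (congrArg Sum.inl (Subtype.ext (T.eq_of_mem_mirror hθ h1 h2)))
  · exact Or.inr ((T.cons_mem_language_iff hθ).2 h)
  · rw [Set.inter_comm] at h
    exact Or.inr ((T.cons_mem_language_iff hθ).2 h)
  · obtain ⟨z, h1, h2⟩ := h
    exact Or.inl (congrArg Sum.inr (Subtype.ext (T.eq_of_mem_interval
      (T.mem_cylinder_append_singleton.1 h1).2 (T.mem_cylinder_append_singleton.1 h2).2)))

theorem not_adj_of_adj_of_adj {w : List A} {x y z}
    (h : (extensionGraph T.language w).Adj x y) (h' : (extensionGraph T.language w).Adj y z) :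
    ¬ (extensionGraph T.language w).Adj x z := by
  rcases x with a | b <;> rcases y with a' | b' <;> rcases z with a'' | b'' <;>
    first
    | exact h.elim
    | exact h'.elim
    | exact id

theorem snd_eq_of_mem_vertexSet {w : List A} {x} {z y : ℝ × Bool}
    (hz : z ∈ T.vertexSet w x) (hy : y ∈ T.vertexSet w x) : z.2 = y.2 := by
  rcases x with a | b
  · exact T.snd_eq_of_mem_mirror hz hy
  · exact T.snd_eq_of_mem_cylinder_append hz hy

theorem nonempty_cylinder_inter_vertexSet (hθ : Function.Involutive θ) {w : List A} (x) :
    (T.cylinder w ∩ T.vertexSet w x).Nonempty := by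
  rcases x with a | b
  · rw [Set.inter_comm]
    exact (T.cons_mem_language_iff hθ).1 a.2
  · obtain ⟨z, hz⟩ := (T.mem_language_iff hθ).1 b.2
    exact ⟨z, (T.mem_cylinder_append_singleton.1 hz).1, hz⟩

theorem isAcyclic_extensionGraph (hθ : Function.Involutive θ) (w : List A) :
    (extensionGraph T.language w).IsAcyclic := by
  refine SimpleGraph.isAcyclic_of_ordConnected _
    (fun x => {l : Bool ×ₗ ℝ | ((ofLex l).2, (ofLex l).1) ∈ T.vertexSet w x}) ?_ ?_ ?_
  · refine fun x => ordConnected_lex_of_slice (fun z hz y hy => snd_eq_of_mem_vertexSet hz hy) ?_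
    rcases x with a | b
    · exact T.ordConnected_mirror_slice a.1
    · exact T.ordConnected_cylinder_slice (w ++ [b.1])
  · intro x y h
    obtain ⟨z, hz⟩ := nonempty_inter_of_adj hθ h
    exact ⟨toLex (z.2, z.1), hz⟩
  · refine fun x y z hxy hyz hne => Set.disjoint_left.2 fun l hl hl' => ?_
    rcases eq_or_adj_of_nonempty_inter hθ ⟨_, hl, hl'⟩ with h | h
    · exact hne h
    · exact not_adj_of_adj_of_adj hxy hyz h

/-- The mirror images miss only `σ₂(Σ)`, and the cylinders of the words `wb` miss only the points
that `T^|w|` sends into `Σ`. A point missed by both would be the start of a connection. -/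
theorem exists_mem_vertexSet (hθ : Function.Involutive θ) (hT : T.WithoutConnections)
    {w : List A} {z : ℝ × Bool} (hz : z ∈ T.cylinder w) : ∃ x, z ∈ T.vertexSet w x := by
  by_cases h : z ∈ sigma2 '' T.divisionPoints
  · have hd : T.map^[w.length] z ∈ T.domain :=
      ⟨T.iterate_mem_space_of_mem_cylinder hz, fun hd => hT z _ w.length
        ⟨h, hd, T.iterate_mem_domain_of_mem_cylinder hz, rfl⟩⟩
    obtain ⟨b, hb⟩ := T.exists_mem_interval hd
    have := T.mem_cylinder_append_singleton.2 ⟨hz, hb⟩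
    exact ⟨Sum.inr ⟨b, (T.mem_language_iff hθ).2 ⟨z, this⟩⟩, this⟩
  · obtain ⟨a, ha⟩ := T.exists_mem_mirror hθ (T.cylinder_subset_space w hz) h
    exact ⟨Sum.inl ⟨a, (T.cons_mem_language_iff hθ).2 ⟨z, ha, hz⟩⟩, ha⟩

theorem reachable_of_snd_eq (hθ : Function.Involutive θ) (hT : T.WithoutConnections)
    {w : List A} {x y} {p q : ℝ × Bool} (hp : p ∈ T.cylinder w ∩ T.vertexSet w x)
    (hq : q ∈ T.cylinder w ∩ T.vertexSet w y) (h : p.2 = q.2) :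
    (extensionGraph T.language w).Reachable x y := by
  refine SimpleGraph.reachable_of_isPreconnected _ (T.isPreconnected_cylinder_row w p.2)
    (T.vertexSet w) ?_ (fun z hz => exists_mem_vertexSet hθ hT hz.1) ?_
    ⟨p, ⟨hp.1, rfl⟩, hp.2⟩ ⟨q, ⟨hq.1, h.symm⟩, hq.2⟩
  · rintro (a | b)
    · exact T.isOpen_mirror a.1
    · exact T.isOpen_cylinder _
  · rintro u v ⟨z, -, hz⟩
    rcases eq_or_adj_of_nonempty_inter hθ ⟨z, hz⟩ with rfl | h
    · exact SimpleGraph.Reachable.refl _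
    · exact h.reachable

theorem isTree_extensionGraph (hθ : Function.Involutive θ) (hT : T.WithoutConnections)
    {w : List A} (hw : w ∈ T.language) (hne : w ≠ []) : (extensionGraph T.language w).IsTree := by
  obtain ⟨z, hz⟩ := (T.mem_language_iff hθ).1 hw
  obtain ⟨x, -⟩ := exists_mem_vertexSet hθ hT hz
  have : Nonempty ({a : A // a :: w ∈ T.language} ⊕ {b : A // w ++ [b] ∈ T.language}) := ⟨x⟩
  refine ⟨⟨fun x y => ?_⟩, isAcyclic_extensionGraph hθ w⟩
  obtain ⟨p, hp⟩ := nonempty_cylinder_inter_vertexSet hθ x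
  obtain ⟨q, hq⟩ := nonempty_cylinder_inter_vertexSet hθ y
  refine reachable_of_snd_eq hθ hT hp hq ?_
  -- The cylinder of a nonempty word lies in the interval of its first letter, hence in one row.
  cases w with
  | nil => exact absurd rfl hne
  | cons a w => exact hp.1.1.2.trans hq.1.1.2.symm

/-- The row of a vertex set is constant along edges, and vertices in the same row are connected, so
components correspond to rows. -/
theorem card_connectedComponent_extensionGraph_nil (hθ : Function.Involutive θ)
    (hT : T.WithoutConnections) :
    Nat.card (extensionGraph T.language []).ConnectedComponent = 2 := by
  choose p hp using fun x => nonempty_cylinder_inter_vertexSet (T := T) hθ (w := []) x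
  have hadj : ∀ x y, (extensionGraph T.language []).Adj x y → (p x).2 = (p y).2 := by
    intro x y h
    obtain ⟨z, hx, hy⟩ := nonempty_inter_of_adj hθ h
    exact (snd_eq_of_mem_vertexSet (hp x).2 hx).trans (snd_eq_of_mem_vertexSet hy (hp y).2)
  have hreach : ∀ x y, (extensionGraph T.language []).Reachable x y → (p x).2 = (p y).2 := by
    rintro x y ⟨q⟩
    induction q with
    | nil => rfl
    | cons h _ ih => exact (hadj _ _ h).trans ih
  let f : (extensionGraph T.language []).ConnectedComponent → Bool :=
    Quot.lift (fun x => (p x).2) hreach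
  have hf : Function.Bijective f := by
    constructor
    · rintro ⟨x⟩ ⟨y⟩ h
      exact SimpleGraph.ConnectedComponent.sound (reachable_of_snd_eq hθ hT (hp x) (hp y) h)
    · intro δ
      -- Any point of row `δ` would do: the covering gives a vertex in that row.
      have hmid : ((T.left + T.right) / 2, δ) ∈ T.cylinder [] :=
        ⟨⟨by linarith [T.left_lt_right], by linarith [T.left_lt_right]⟩, trivial⟩
      obtain ⟨x, hx⟩ := exists_mem_vertexSet hθ hT hmid
      exact ⟨Quot.mk _ x, snd_eq_of_mem_vertexSet (hp x).2 hx⟩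
  rw [Nat.card_eq_of_bijective f hf, Nat.card_eq_fintype_card, Fintype.card_bool]

end LinearInvolution

theorem mainTheorem11 {A : Type*} [Finite A] (θ : A → A) (hθ : Function.Involutive θ)
    (T : LinearInvolution A θ) (hT : T.WithoutConnections) :
    IsSpecularSet θ T.language :=
  ⟨T.isLaminarySet_language hθ, T.isBiextendableSet_language hθ,
    fun _ hw hne => LinearInvolution.isTree_extensionGraph hθ hT hw hne,
    LinearInvolution.isAcyclic_extensionGraph hθ [],
    LinearInvolution.card_connectedComponent_extensionGraph_nil hθ hT⟩
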